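/- Let $k$ be an arbitrary field, $T=k[s,t,u]$ with its standard grading, $\mathfrak m=(s,t,u)$, $k=T/\mathfrak m$, and let $J\subset T$ be a homogeneous ideal with Hilbert function $H_J(q)=\dim_k J_q$ for $q\in\mathbb Z$ (so $H_J(q)=0$ for $q<0$). Then $J$ has a minimal graded free resolution $\cdots\to F_1\to F_0\to J\to 0$ by finitely generated graded free modules, and for every such resolution, with graded Betti numbers $\beta_{i,p}(J)$ (the number of summands $T(-p)$ of $F_i$), Betti numbers $\beta_i(J)=\sum_p\beta_{i,p}(J)=\operatorname{rank}F_i$ and regularity $\operatorname{reg}(J)=\max\{p-i : \beta_{i,p}(J)\ne 0\}$ (for $J\neq 0$), the following hold. 1. For every $p\in\mathbb Z$, $$\beta_{2,p}(J)=\dim_k \operatorname{Tor}_2^T(J,k)_p\le H_J(p-2)-H_J(p-3),$$ where $\operatorname{Tor}_2^T(J,k)_p$ is the degree $p$ part of $H_2(G\otimes_T k)$ for any graded free resolution $G$ of $J$ by finitely generated graded free modules. 2. If $J\ne 0$, then the maximum defining $\operatorname{reg}(J)$ exists and $\beta_2(J)\le H_J(\operatorname{reg}(J))$. 3. If $J=(f_1,\dots,f_m)$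 with $m\ge 2$, $\gcd(f_1,\dots,f_m)=1$ and $\deg(f_1),\dots,\deg(f_m)\le d$ for an integer $d\ge 1$, then $$\beta_2(J)\le H_J(\operatorname{reg}(J))\le H_J(3d-2).$$ -/

import Mathlib

open MvPolynomial
open scoped TensorProduct

attribute [local instance] MvPolynomial.gradedAlgebra

/-- The polynomial ring `T = k[s,t,u]`, with `s = X 0`, `t = X 1`, `u = X 2`. -/
abbrev PolyRing (k : Type*) [Field k] : Type _ := MvPolynomial (Fin 3) k

/-- The graded piece `T_q` of `T = k[s,t,u]` for an integer `q` (zero for `q < 0`): the forms all of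
whose monomials have total degree `q`. -/
abbrev polyPiece (k : Type*) [Field k] (q : ℤ) : Submodule k (PolyRing k) :=
  weightedHomogeneousSubmodule k (fun _ : Fin 3 => (1 : ℤ)) q

/-- The maximal homogeneous ideal `𝔪 = (s,t,u)`. -/
noncomputable def maxIdeal (k : Type*) [Field k] : Ideal (PolyRing k) :=
  Ideal.span (Set.range (X : Fin 3 → PolyRing k))

/-- The residue field `k = T/𝔪`, as a `T`-module. -/
abbrev ResidueModule (k : Type*) [Field k] : Type _ := PolyRing k ⧸ maxIdeal k

/-- The Hilbert function `H_J(q) = dim_k J_q`, `q ∈ ℤ`, of an ideal `J` of `T`. -/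
noncomputable def hilbertFn {k : Type*} [Field k] (J : Ideal (PolyRing k)) (q : ℤ) : ℕ :=
  Module.finrank k ↥(J.restrictScalars k ⊓ polyPiece k q)

/-- The degree `p` piece of the graded free module `⨁ j, T(-e j)`: the vectors whose `j`-th entry is
a form of degree `p - e j`. -/
noncomputable def freePiece {k : Type*} [Field k] {r : ℕ} (e : Fin r → ℤ) (p : ℤ) :
    Submodule k (Fin r → PolyRing k) :=
  Submodule.pi Set.univ (fun j => polyPiece k (p - e j))

/-- A graded free resolution
`⋯ → F 2 → F 1 → F 0 → J → 0` of an ideal `J` of `T`, where `F i = ⨁ j, T(-deg i j)` is a finitely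
generated graded free module (`j` runs through `Fin (rank i)`) and all maps are homogeneous of
degree zero. -/
structure GradedFreeResolution {k : Type*} [Field k] (J : Ideal (PolyRing k)) where
  rank : ℕ → ℕ
  deg : (i : ℕ) → Fin (rank i) → ℤ
  /-- The differential `F (i + 1) → F i`. -/
  d : (i : ℕ) → (Fin (rank (i + 1)) → PolyRing k) →ₗ[PolyRing k] (Fin (rank i) → PolyRing k)
  /-- The augmentation `F 0 → J ⊆ T`. -/
  aug : (Fin (rank 0) → PolyRing k) →ₗ[PolyRing k] PolyRing k
  d_graded : ∀ (i : ℕ) (p : ℤ), ∀ v ∈ freePiece (deg (i + 1)) p, d i v ∈ freePiece (deg i) p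
  aug_graded : ∀ (p : ℤ), ∀ v ∈ freePiece (deg 0) p, aug v ∈ polyPiece k p
  range_aug : LinearMap.range aug = J
  exact_zero : LinearMap.ker aug = LinearMap.range (d 0)
  exact_succ : ∀ i : ℕ, LinearMap.ker (d i) = LinearMap.range (d (i + 1))

namespace GradedFreeResolution

variable {k : Type*} [Field k] {J : Ideal (PolyRing k)}

/-- The resolution is minimal: `d (F (i + 1)) ⊆ 𝔪 F i` for all `i`. -/
def IsMinimal (F : GradedFreeResolution J) : Prop :=
  ∀ i : ℕ, LinearMap.range (F.d i) ≤
    maxIdeal k • (⊤ : Submodule (PolyRing k) (Fin (F.rank i) → PolyRing k))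

/-- The number of summands `T(-p)` of `F i`. For a minimal resolution this is the graded Betti
number `β_{i,p}(J)`. -/
def gradedBetti (F : GradedFreeResolution J) (i : ℕ) (p : ℤ) : ℕ :=
  (Finset.univ.filter (fun j : Fin (F.rank i) => F.deg i j = p)).card

/-- The rank of `F i`. For a minimal resolution this is the Betti number `β_i(J)`. -/
def betti (F : GradedFreeResolution J) (i : ℕ) : ℕ := F.rank i

/-- The set of all `p - i` with `β_{i,p} ≠ 0`. -/
def shifts (F : GradedFreeResolution J) : Set ℤ :=
  {q | ∃ (i : ℕ) (p : ℤ), F.gradedBetti i p ≠ 0 ∧ q = p - i}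

/-- For a minimal resolution of a nonzero ideal: the Castelnuovo-Mumford regularity
`reg J = max {p - i | β_{i,p}(J) ≠ 0}`. -/
noncomputable def reg (F : GradedFreeResolution J) : ℤ := sSup F.shifts

/-- The term `F i ⊗ k` of the complex `F ⊗ k`. -/
def TensorTerm (F : GradedFreeResolution J) (i : ℕ) : Type _ :=
  (Fin (F.rank i) → PolyRing k) ⊗[PolyRing k] ResidueModule k

noncomputable instance (F : GradedFreeResolution J) (i : ℕ) : AddCommGroup (F.TensorTerm i) :=
  inferInstanceAs (AddCommGroup ((Fin (F.rank i) → PolyRing k) ⊗[PolyRing k] ResidueModule k))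

noncomputable instance (F : GradedFreeResolution J) (i : ℕ) : Module k (F.TensorTerm i) :=
  inferInstanceAs (Module k ((Fin (F.rank i) → PolyRing k) ⊗[PolyRing k] ResidueModule k))

/-- The differential `F (i + 1) ⊗ k → F i ⊗ k`, as a `k`-linear map. -/
noncomputable def tensorD (F : GradedFreeResolution J) (i : ℕ) :
    F.TensorTerm (i + 1) →ₗ[k] F.TensorTerm i :=
  ((F.d i).rTensor (ResidueModule k)).restrictScalars k

/-- The `k`-linear map `F i → F i ⊗ k`, `v ↦ v ⊗ 1`. -/
noncomputable def toTensor (F : GradedFreeResolution J) (i : ℕ) :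
    (Fin (F.rank i) → PolyRing k) →ₗ[k] F.TensorTerm i :=
  ((TensorProduct.mk (PolyRing k) (Fin (F.rank i) → PolyRing k) (ResidueModule k)).flip
    1).restrictScalars k

/-- The degree `p` piece of `F i ⊗ k` (with `k` in degree zero): all `v ⊗ 1` with `v` in the degree
`p` piece of `F i`. -/
noncomputable def tensorPiece (F : GradedFreeResolution J) (i : ℕ) (p : ℤ) :
    Submodule k (F.TensorTerm i) :=
  (freePiece (F.deg i) p).map (F.toTensor i)

/-- The cycles of degree `p` in `F i ⊗ k`. -/
noncomputable def cycles (F : GradedFreeResolution J) : (i : ℕ) → (p : ℤ) →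
    Submodule k (F.TensorTerm i)
  | 0, p => F.tensorPiece 0 p
  | i + 1, p => LinearMap.ker (F.tensorD i) ⊓ F.tensorPiece (i + 1) p

/-- The boundaries of degree `p` in `F i ⊗ k`. -/
noncomputable def boundaries (F : GradedFreeResolution J) (i : ℕ) (p : ℤ) :
    Submodule k (F.TensorTerm i) :=
  (F.tensorPiece (i + 1) p).map (F.tensorD i)

/-- The graded component `Tor_i(J, k)_p`, computed from the graded free resolution `F` of `J`:
the degree `p` part of the `i`-th homology of `F ⊗ k`. -/
abbrev TorPiece (F : GradedFreeResolution J) (i : ℕ) (p : ℤ) : Type _ :=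
  ↥(F.cycles i p) ⧸ (F.boundaries i p).submoduleOf (F.cycles i p)

end GradedFreeResolution

/-!
The bounds for the second Betti numbers come from the socle of `T / J`, the bound for the regularity
from null homotopies on a minimal resolution `F` of `J`.

*Second Betti numbers.* `Tor₂(J, k)_p` is the socle of `T / J` in degree `p - 3`: a cycle of `G ⊗ k`
in homological degree two and a form `c` with `s c, t c, u c ∈ J` correspond to each other when they
are joined by a zigzag through the double complex `G ⊗ K`, where `K` is the Koszul complex of
`s, t, u` (`koszulZigzag`, `GradedFreeResolution.finrank_torPiece_two`). This is a statement about an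
arbitrary graded free resolution `G`, and in a minimal resolution `Tor` counts the summands
(`GradedFreeResolution.IsMinimal.finrank_torPiece_succ`). Multiplication by `s` embeds the forms `c`
of degree `p - 3` into `J_{p - 2}`, and those that lie in `J` are divided out; this is the bound
`H_J(p - 2) - H_J(p - 3)`. The same zigzag, started one step further to the left, shows that
`F 3 = 0` for minimal `F`, so that the regularity is the maximum of a finite set, and the sum of the
bounds over all `p ≤ reg J + 2` telescopes to `H_J(reg J)`.

*The regularity.* Let `J` be generated in degrees at most `d` by elements without a common divisor.
The generators `ε i` of `F 0` have degrees at most `d`. Let `f i` be the image of `ε i` in `J`.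
Multiplication by `f i` on the resolution of `T / J` is null homotopic, by a homogeneous homotopy
`h i` with `h i 1 = ε i`. Suppose that `F 2` has a basis vector of degree `> 3d`, with coordinate
function `e`. Then `e (h i (h j (ε n)))` has negative degree and vanishes, for all `i, j, n`. From
`e ∘ h i ∘ h j = 0` on `F 0` one gets `f j * e ∘ h i = f i * e ∘ h j` on `F 1`, hence `f i` divides
`e ∘ h i`, because the `f j` have no common divisor. Since `f i * e = e ∘ h i ∘ d`, the function `e`
factors through `d`; but `d` has entries in `𝔪`, and `e` takes the value `1`
(`GradedFreeResolution.IsMinimal.deg_two_le`). A shorter argument of the same kind bounds the degrees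
of `F 1` by `3d - 1` (`GradedFreeResolution.IsMinimal.deg_one_le`). So `reg J ≤ 3d - 2`, and `H_J` is
monotone.

*Existence.* A shortest system of homogeneous generators of a graded submodule of a graded free
module has all its syzygies in `𝔪` times the free module (`nonempty_minimalCover`); iterating this
gives a minimal resolution (`exists_isMinimal`).
-/

/-! ### Projections onto graded pieces -/

/-- `π q` is the projection of `M` onto the piece `𝒜 q` along the other pieces, and the pieces span
`M`; a grading of `M` by `ℤ` in the form in which it is used below. -/
structure IsProjectionFamily {k M : Type*} [Field k] [AddCommGroup M] [Module k M]
    (𝒜 : ℤ → Submodule k M) (π : ℤ → M →ₗ[k] M) : Prop where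
  iSup_eq_top : ⨆ q, 𝒜 q = ⊤
  apply_self : ∀ {q v}, v ∈ 𝒜 q → π q v = v
  apply_of_ne : ∀ {q q' v}, v ∈ 𝒜 q' → q ≠ q' → π q v = 0

/-- A homogeneous map of degree `a` commutes with the projections. -/
theorem IsProjectionFamily.apply_comm {k M M' : Type*} [Field k] [AddCommGroup M] [Module k M]
    [AddCommGroup M'] [Module k M'] {𝒜 : ℤ → Submodule k M} {π : ℤ → M →ₗ[k] M}
    {ℬ : ℤ → Submodule k M'} {ρ : ℤ → M' →ₗ[k] M'} (hπ : IsProjectionFamily 𝒜 π)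
    (hρ : IsProjectionFamily ℬ ρ) (L : M →ₗ[k] M') (a : ℤ)
    (hL : ∀ q, ∀ v ∈ 𝒜 q, L v ∈ ℬ (q + a)) (q : ℤ) (v : M) :
    ρ (q + a) (L v) = L (π q v) := by
  have hv : v ∈ ⨆ q, 𝒜 q := hπ.iSup_eq_top ▸ Submodule.mem_top
  induction hv using Submodule.iSup_induction' with
  | mem q' v hv =>
    by_cases h : q = q'
    · subst h
      rw [hπ.apply_self hv, hρ.apply_self (hL _ _ hv)]
    · rw [hπ.apply_of_ne hv h, hρ.apply_of_ne (hL _ _ hv) (by omega), map_zero]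
  | zero => simp
  | add x y _ _ hx hy => simp [hx, hy]

section Grading

variable {k : Type*} [Field k]

/-- The component of degree `q` of a polynomial, for an integer `q`. -/
noncomputable def polyComp (k : Type*) [Field k] (q : ℤ) : PolyRing k →ₗ[k] PolyRing k :=
  weightedHomogeneousComponent (fun _ : Fin 3 => (1 : ℤ)) q

/-- The component of degree `p` of a vector of the graded free module `⨁ j, T(-e j)`. -/
noncomputable def freeComp {r : ℕ} (e : Fin r → ℤ) (p : ℤ) :
    (Fin r → PolyRing k) →ₗ[k] (Fin r → PolyRing k) :=
  LinearMap.pi fun j => polyComp k (p - e j) ∘ₗ LinearMap.proj j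

theorem freeComp_apply {r : ℕ} (e : Fin r → ℤ) (p : ℤ) (v : Fin r → PolyRing k) (j : Fin r) :
    freeComp e p v j = polyComp k (p - e j) (v j) := rfl

theorem mem_freePiece {r : ℕ} {e : Fin r → ℤ} {p : ℤ} {v : Fin r → PolyRing k} :
    v ∈ freePiece e p ↔ ∀ j, v j ∈ polyPiece k (p - e j) := by
  simp [freePiece, Submodule.mem_pi]

theorem polyComp_mem (q : ℤ) (f : PolyRing k) : polyComp k q f ∈ polyPiece k q :=
  weightedHomogeneousComponent_mem _ _ _

theorem freeComp_mem {r : ℕ} (e : Fin r → ℤ) (p : ℤ) (v : Fin r → PolyRing k) :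
    freeComp e p v ∈ freePiece e p :=
  mem_freePiece.2 fun _ => polyComp_mem _ _

theorem polyComp_isProjectionFamily : IsProjectionFamily (polyPiece k) (polyComp k) where
  iSup_eq_top := by
    refine eq_top_iff.2 fun f _ => ?_
    rw [f.as_sum]
    refine Submodule.sum_mem _ fun m _ => ?_
    exact Submodule.mem_iSup_of_mem (Finsupp.weight (fun _ : Fin 3 => (1 : ℤ)) m)
      (isWeightedHomogeneous_monomial _ _ _ rfl)
  apply_self := fun {q v} hv =>
    IsWeightedHomogeneous.weightedHomogeneousComponent_same (p := v) (m := q) hv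
  apply_of_ne := fun {q q' v} hv h =>
    IsWeightedHomogeneous.weightedHomogeneousComponent_ne (p := v) (m := q') q hv h

theorem polyComp_of_mem {q : ℤ} {f : PolyRing k} (hf : f ∈ polyPiece k q) : polyComp k q f = f :=
  polyComp_isProjectionFamily.apply_self hf

theorem single_mem_freePiece {r : ℕ} (e : Fin r → ℤ) (j : Fin r) {f : PolyRing k} {p : ℤ}
    (hf : f ∈ polyPiece k (p - e j)) : Pi.single j f ∈ freePiece e p := by
  refine mem_freePiece.2 fun i => ?_
  rcases eq_or_ne i j with rfl | h
  · simpa using hf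
  · simp [h]

theorem freeComp_isProjectionFamily {r : ℕ} (e : Fin r → ℤ) :
    IsProjectionFamily (k := k) (freePiece e) (freeComp e) where
  iSup_eq_top := by
    refine eq_top_iff.2 fun v _ => ?_
    rw [← Finset.univ_sum_single v]
    refine Submodule.sum_mem _ fun j _ => ?_
    have hv : v j ∈ ⨆ q : ℤ, (polyPiece k q : Submodule k (PolyRing k)) :=
      (polyComp_isProjectionFamily (k := k)).iSup_eq_top ▸ Submodule.mem_top
    generalize v j = f at hv
    induction hv using Submodule.iSup_induction' with
    | mem q f hf =>
      exact Submodule.mem_iSup_of_mem (q + e j) (single_mem_freePiece e j (by simpa using hf))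
    | zero => simp
    | add f g _ _ hf hg => rw [Pi.single_add]; exact Submodule.add_mem _ hf hg
  apply_self := fun hv => funext fun j => polyComp_of_mem (mem_freePiece.1 hv j)
  apply_of_ne := fun hv h => funext fun j =>
    polyComp_isProjectionFamily.apply_of_ne (mem_freePiece.1 hv j) (by omega)

theorem freeComp_of_mem {r : ℕ} {e : Fin r → ℤ} {p : ℤ} {v : Fin r → PolyRing k}
    (hv : v ∈ freePiece e p) : freeComp e p v = v :=
  (freeComp_isProjectionFamily e).apply_self hv

theorem X_mem_polyPiece (i : Fin 3) : (X i : PolyRing k) ∈ polyPiece k 1 :=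
  isWeightedHomogeneous_X k (fun _ : Fin 3 => (1 : ℤ)) i

theorem mul_mem_polyPiece {f g : PolyRing k} {a b : ℤ} (hf : f ∈ polyPiece k a)
    (hg : g ∈ polyPiece k b) : f * g ∈ polyPiece k (a + b) :=
  IsWeightedHomogeneous.mul hf hg

theorem polyComp_X_mul (i : Fin 3) (q : ℤ) (f : PolyRing k) :
    polyComp k (q + 1) (X i * f) = X i * polyComp k q f :=
  polyComp_isProjectionFamily.apply_comm polyComp_isProjectionFamily
    (LinearMap.mulLeft k (X i)) 1
    (fun q _ hv => add_comm 1 q ▸ mul_mem_polyPiece (X_mem_polyPiece i) hv) q f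

theorem freeComp_X_smul {r : ℕ} (e : Fin r → ℤ) (i : Fin 3) (q : ℤ) (v : Fin r → PolyRing k) :
    freeComp e (q + 1) ((X i : PolyRing k) • v) = (X i : PolyRing k) • freeComp e q v := by
  funext j
  rw [freeComp_apply, Pi.smul_apply, smul_eq_mul, show q + 1 - e j = q - e j + 1 by ring,
    polyComp_X_mul]
  rfl

/-- A map of degree zero between graded free modules commutes with the projections. -/
theorem freeComp_map {r r' : ℕ} {e : Fin r → ℤ} {e' : Fin r' → ℤ}
    (L : (Fin r → PolyRing k) →ₗ[PolyRing k] (Fin r' → PolyRing k))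
    (hL : ∀ p, ∀ v ∈ freePiece e p, L v ∈ freePiece e' p) (p : ℤ) (v : Fin r → PolyRing k) :
    freeComp e' p (L v) = L (freeComp e p v) := by
  simpa using (freeComp_isProjectionFamily e).apply_comm (freeComp_isProjectionFamily e')
    (L.restrictScalars k) 0 (by simpa using hL) p v

theorem polyComp_map {r : ℕ} {e : Fin r → ℤ}
    (L : (Fin r → PolyRing k) →ₗ[PolyRing k] PolyRing k)
    (hL : ∀ p, ∀ v ∈ freePiece e p, L v ∈ polyPiece k p) (p : ℤ) (v : Fin r → PolyRing k) :
    polyComp k p (L v) = L (freeComp e p v) := by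
  simpa using (freeComp_isProjectionFamily e).apply_comm polyComp_isProjectionFamily
    (L.restrictScalars k) 0 (by simpa using hL) p v

theorem weight_one_eq_degree (m : Fin 3 →₀ ℕ) :
    Finsupp.weight (fun _ : Fin 3 => (1 : ℤ)) m = (m.degree : ℤ) := by
  simp [Finsupp.weight_eq_sum, Finsupp.degree_eq_sum]

theorem coeff_polyComp (q : ℤ) (f : PolyRing k) (m : Fin 3 →₀ ℕ) :
    coeff m (polyComp k q f) = if (m.degree : ℤ) = q then coeff m f else 0 := by
  classical
  rw [polyComp, coeff_weightedHomogeneousComponent, weight_one_eq_degree]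

theorem polyComp_natCast (n : ℕ) (f : PolyRing k) :
    polyComp k n f = homogeneousComponent n f := by
  ext m
  rw [coeff_polyComp, coeff_homogeneousComponent]
  simp

theorem eq_zero_of_mem_polyPiece_of_neg {q : ℤ} (hq : q < 0) {f : PolyRing k}
    (hf : f ∈ polyPiece k q) : f = 0 := by
  rw [← polyComp_of_mem hf]
  ext m
  rw [coeff_polyComp, if_neg (by omega), coeff_zero]

theorem polyComp_zero_eq (f : PolyRing k) : polyComp k 0 f = C (constantCoeff f) := by
  have := polyComp_natCast 0 f
  rw [Nat.cast_zero] at this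
  rw [this, homogeneousComponent_zero, constantCoeff_eq]

theorem eq_C_of_mem_polyPiece_zero {f : PolyRing k} (hf : f ∈ polyPiece k 0) :
    f = C (constantCoeff f) := by
  rw [← polyComp_zero_eq, polyComp_of_mem hf]

theorem C_mem_polyPiece (a : k) : (C a : PolyRing k) ∈ polyPiece k 0 :=
  isWeightedHomogeneous_C _ a

theorem single_one_mem_freePiece {r : ℕ} (e : Fin r → ℤ) (j : Fin r) :
    (Pi.single j 1 : Fin r → PolyRing k) ∈ freePiece e (e j) :=
  single_mem_freePiece e j (by rw [sub_self, ← C_1]; exact C_mem_polyPiece 1)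

theorem smul_mem_freePiece {r : ℕ} {e : Fin r → ℤ} {g : PolyRing k} {v : Fin r → PolyRing k}
    {p q : ℤ} (hg : g ∈ polyPiece k p) (hv : v ∈ freePiece e q) : g • v ∈ freePiece e (p + q) :=
  mem_freePiece.2 fun j => by
    rw [add_sub_assoc]
    exact mul_mem_polyPiece hg (mem_freePiece.1 hv j)

theorem eq_zero_of_mem_freePiece_of_lt {r : ℕ} {e : Fin r → ℤ} {p : ℤ} {v : Fin r → PolyRing k}
    (hv : v ∈ freePiece e p) {j : Fin r} (hj : p < e j) : v j = 0 :=
  eq_zero_of_mem_polyPiece_of_neg (by omega) (mem_freePiece.1 hv j)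

theorem constantCoeff_eq_zero_of_mem_polyPiece {q : ℤ} (hq : q ≠ 0) {f : PolyRing k}
    (hf : f ∈ polyPiece k q) : constantCoeff f = 0 := by
  rw [← polyComp_of_mem hf, constantCoeff_eq, coeff_polyComp, if_neg]
  simpa using hq.symm

theorem polyComp_mem_of_isHomogeneous {J : Ideal (PolyRing k)}
    (hJ : J.IsHomogeneous (homogeneousSubmodule (Fin 3) k)) {f : PolyRing k} (hf : f ∈ J) (q : ℤ) :
    polyComp k q f ∈ J := by
  rcases lt_or_ge q 0 with hq | hq
  · rw [eq_zero_of_mem_polyPiece_of_neg hq (polyComp_mem q f)]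
    exact J.zero_mem
  · lift q to ℕ using hq
    rw [polyComp_natCast]
    exact homogeneousComponent_mem_of_mem hJ hf q

instance (q : ℤ) : FiniteDimensional k (polyPiece k q) := by
  have : polyPiece k q ≤ restrictTotalDegree (Fin 3) k q.toNat := by
    intro f hf
    rw [mem_restrictTotalDegree]
    refine Finset.sup_le fun m hm => ?_
    have h := hf (mem_support_iff.1 hm)
    rw [weight_one_eq_degree] at h
    change m.degree ≤ _
    omega
  exact Submodule.finiteDimensional_of_le this

end Grading

/-! ### The Koszul complex of the variables -/

section Koszul

variable {k : Type*} [Field k]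

theorem mem_maxIdeal_iff {f : PolyRing k} : f ∈ maxIdeal k ↔ constantCoeff f = 0 := by
  rw [maxIdeal, ← Set.image_univ, mem_ideal_span_X_image, constantCoeff_eq]
  constructor
  · intro h
    by_contra h0
    obtain ⟨i, -, hi⟩ := h 0 (mem_support_iff.2 h0)
    exact hi rfl
  · intro h m hm
    by_contra! hc
    have : m = 0 := Finsupp.ext fun i => hc i trivial
    exact mem_support_iff.1 hm (this ▸ h)

theorem mem_maxIdeal_smul_top_iff {r : ℕ} {v : Fin r → PolyRing k} :
    v ∈ maxIdeal k • (⊤ : Submodule (PolyRing k) (Fin r → PolyRing k)) ↔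
      ∀ j, constantCoeff (v j) = 0 := by
  constructor
  · intro h
    induction h using Submodule.smul_induction_on' with
    | smul f hf w _ => intro j; simp [mem_maxIdeal_iff.1 hf]
    | add x _ y _ hx hy => intro j; simp [hx j, hy j]
  · intro h
    rw [← Finset.univ_sum_single v]
    refine Submodule.sum_mem _ fun j _ => ?_
    have : Pi.single j (v j) = v j • (Pi.single j 1 : Fin r → PolyRing k) := by
      rw [← Pi.single_smul, smul_eq_mul, mul_one]
    rw [this]
    exact Submodule.smul_mem_smul (mem_maxIdeal_iff.2 (h j)) trivial

theorem mem_maxIdeal_smul_top_iff_exists {M : Type*} [AddCommGroup M] [Module (PolyRing k) M]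
    {v : M} : v ∈ maxIdeal k • (⊤ : Submodule (PolyRing k) M) ↔
      ∃ a : Fin 3 → M, v = ∑ i, (X i : PolyRing k) • a i := by
  constructor
  · intro h
    induction h using Submodule.smul_induction_on' with
    | smul f hf w _ =>
      obtain ⟨c, rfl⟩ := Ideal.mem_span_range_iff_exists_fun.1 hf
      refine ⟨fun i => c i • w, ?_⟩
      rw [Finset.sum_smul]
      exact Finset.sum_congr rfl fun i _ => by rw [smul_smul, mul_comm]
    | add x _ y _ hx hy =>
      obtain ⟨a, rfl⟩ := hx
      obtain ⟨b, rfl⟩ := hy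
      exact ⟨a + b, by simp [Finset.sum_add_distrib]⟩
  · rintro ⟨a, rfl⟩
    exact Submodule.sum_mem _ fun i _ =>
      Submodule.smul_mem_smul (Ideal.subset_span ⟨i, rfl⟩) trivial

/-- The Koszul differential `M³ → M³` in the middle of the Koszul complex of `s, t, u` on `M`. -/
noncomputable def koszulCurl (k : Type*) [Field k] {M : Type*} [AddCommGroup M]
    [Module (PolyRing k) M]    (b : Fin 3 → M) : Fin 3 → M :=
  ![(X 1 : PolyRing k) • b 2 - (X 2 : PolyRing k) • b 1,
    (X 2 : PolyRing k) • b 0 - (X 0 : PolyRing k) • b 2,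
    (X 0 : PolyRing k) • b 1 - (X 1 : PolyRing k) • b 0]

/-- Exactness of the Koszul complex `M → M³ → M³ → M` of `s, t, u` at the two middle terms. -/
structure KoszulExact (k : Type*) [Field k] (M : Type*) [AddCommGroup M]
    [Module (PolyRing k) M] : Prop where
  exists_curl : ∀ a : Fin 3 → M, ∑ i, (X i : PolyRing k) • a i = 0 → ∃ b, a = koszulCurl k b
  exists_smul : ∀ b : Fin 3 → M, koszulCurl k b = 0 → ∃ c, ∀ i, b i = (X i : PolyRing k) • c

theorem X_dvd_of_dvd_X_mul {i j : Fin 3} (hij : i ≠ j) {f : PolyRing k}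
    (h : (X i : PolyRing k) ∣ X j * f) : (X i : PolyRing k) ∣ f := by
  refine ((X_prime (R := k) (i := i)).dvd_or_dvd h).resolve_left fun h => hij ?_
  simpa using h

theorem koszulExact_polyRing : KoszulExact k (PolyRing k) where
  exists_curl := by
    intro a ha
    simp only [Fin.sum_univ_three, smul_eq_mul] at ha
    -- Modulo `s` and `t` the relation says that `u * a 2` vanishes.
    have h2 : a 2 ∈ Ideal.span (X '' ({0, 1} : Set (Fin 3)) : Set (PolyRing k)) := by
      rw [mem_ideal_span_X_image]
      intro m hm
      by_contra! hc
      have h0 : m 0 = 0 := hc 0 (by simp)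
      have h1 : m 1 = 0 := hc 1 (by simp)
      have := congrArg (coeff (m + Finsupp.single 2 1)) ha
      rw [coeff_add, coeff_add, mul_comm (X 2), coeff_mul_X, coeff_X_mul', coeff_X_mul',
        if_neg (by simp [h0]), if_neg (by simp [h1])] at this
      exact mem_support_iff.1 hm (by simpa using this)
    rw [Set.image_pair, Ideal.mem_span_pair] at h2
    obtain ⟨p, q, hpq⟩ := h2
    have h : (X 0 : PolyRing k) * (a 0 + X 2 * p) = X 1 * -(a 1 + X 2 * q) := by
      rw [← hpq] at ha
      linear_combination ha
    obtain ⟨r, hr⟩ := X_dvd_of_dvd_X_mul (i := 1) (j := 0) (by decide) (Dvd.intro _ h.symm)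
    have h' : -(a 1 + X 2 * q) = X 0 * r := by
      refine mul_left_cancel₀ (X_ne_zero (R := k) (1 : Fin 3)) ?_
      rw [← h, hr]; ring
    refine ⟨![-q, p, r], funext fun i => ?_⟩
    fin_cases i
    · simp only [koszulCurl]; simp; linear_combination hr
    · simp only [koszulCurl]; simp; linear_combination -h'
    · simp only [koszulCurl]; simp; linear_combination -hpq
  exists_smul := by
    intro b hb
    have h1 := congrFun hb 1
    have h2 := congrFun hb 2
    simp [koszulCurl, sub_eq_zero] at h1 h2
    obtain ⟨c, hc⟩ := X_dvd_of_dvd_X_mul (i := 0) (j := 1) (by decide) (Dvd.intro _ h2)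
    have h0 := X_ne_zero (R := k) (0 : Fin 3)
    refine ⟨c, fun i => ?_⟩
    fin_cases i
    · exact hc
    · refine mul_left_cancel₀ h0 ?_
      simp [h2, hc]; ring
    · refine mul_left_cancel₀ h0 ?_
      simp [← h1, hc]; ring

theorem koszulExact_pi {r : ℕ} : KoszulExact k (Fin r → PolyRing k) where
  exists_curl := by
    intro a ha
    have (j : Fin r) := koszulExact_polyRing.exists_curl (k := k) (fun i => a i j)
      (by simpa using congrFun ha j)
    choose b hb using this
    refine ⟨fun i j => b j i, funext fun i => funext fun j => ?_⟩
    have := congrFun (hb j) i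
    fin_cases i <;> simpa [koszulCurl] using this
  exists_smul := by
    intro b hb
    have (j : Fin r) := koszulExact_polyRing.exists_smul (k := k) (fun i => b i j) (by
      funext i
      have := congrFun (congrFun hb i) j
      fin_cases i <;> simpa [koszulCurl] using this)
    choose c hc using this
    exact ⟨c, fun i => funext fun j => hc j i⟩

theorem map_koszulCurl {M N : Type*} [AddCommGroup M] [Module (PolyRing k) M] [AddCommGroup N]
    [Module (PolyRing k) N] (L : M →ₗ[PolyRing k] N) (b : Fin 3 → M) (i : Fin 3) :
    L (koszulCurl k b i) = koszulCurl k (fun j => L (b j)) i := by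
  fin_cases i <;> simp [koszulCurl]

theorem koszulCurl_add {M : Type*} [AddCommGroup M] [Module (PolyRing k) M]
    (b b' : Fin 3 → M) : koszulCurl k (b + b') = koszulCurl k b + koszulCurl k b' := by
  funext i
  fin_cases i <;> simp [koszulCurl] <;> abel

theorem koszulCurl_sub {M : Type*} [AddCommGroup M] [Module (PolyRing k) M]
    (b b' : Fin 3 → M) : koszulCurl k (b - b') = koszulCurl k b - koszulCurl k b' := by
  funext i
  fin_cases i <;> simp [koszulCurl, smul_sub] <;> abel

theorem koszulCurl_smul {M : Type*} [AddCommGroup M] [Module (PolyRing k) M]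
    (f : PolyRing k) (b : Fin 3 → M) : koszulCurl k (f • b) = f • koszulCurl k b := by
  funext i
  fin_cases i <;> simp [koszulCurl, smul_sub, smul_comm f]

theorem koszulCurl_X_smul {M : Type*} [AddCommGroup M] [Module (PolyRing k) M] (c : M) :
    koszulCurl k (fun i => (X i : PolyRing k) • c) = 0 := by
  funext i
  fin_cases i <;> simp [koszulCurl, smul_smul, mul_comm]

theorem sum_X_smul_koszulCurl {M : Type*} [AddCommGroup M] [Module (PolyRing k) M]
    (b : Fin 3 → M) : ∑ i, (X i : PolyRing k) • koszulCurl k b i = 0 := by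
  simp only [Fin.sum_univ_three, koszulCurl]
  simp only [Matrix.cons_val, smul_sub, smul_smul]
  rw [mul_comm (X 1) (X 0), mul_comm (X 2) (X 0), mul_comm (X 2) (X 1)]
  abel

/-! ### The zigzag between a complex and the Koszul complex -/

section Zigzag

variable {P₀ P₁ P₂ P₃ P₄ : Type*}
  [AddCommGroup P₀] [Module (PolyRing k) P₀] [AddCommGroup P₁] [Module (PolyRing k) P₁]
  [AddCommGroup P₂] [Module (PolyRing k) P₂] [AddCommGroup P₃] [Module (PolyRing k) P₃]
  [AddCommGroup P₄] [Module (PolyRing k) P₄]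
  (d₁ : P₁ →ₗ[PolyRing k] P₀) (d₂ : P₂ →ₗ[PolyRing k] P₁) (d₃ : P₃ →ₗ[PolyRing k] P₂)
  (d₄ : P₄ →ₗ[PolyRing k] P₃)

/-- For a complex `P₃ → P₂ → P₁ → P₀`, the pairs `(z, c) ∈ P₃ × P₀` that are joined by a zigzag
through the double complex obtained by tensoring with the Koszul complex of `s, t, u`. It induces
the isomorphism between the homology of `P ⊗ k` at `P₃` and the elements of `P₀ / d₁ P₁` killed
by `𝔪`. -/
noncomputable def koszulZigzag : Submodule (PolyRing k) (P₃ × P₀) where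
  carrier := {x | ∃ (a : Fin 3 → P₂) (b : Fin 3 → P₁),
    d₃ x.1 = ∑ i, (X i : PolyRing k) • a i ∧ (fun i => d₂ (a i)) = koszulCurl k b ∧
    ∀ i, d₁ (b i) = (X i : PolyRing k) • x.2}
  add_mem' := by
    rintro x y ⟨a, b, h₁, h₂, h₃⟩ ⟨a', b', h₁', h₂', h₃'⟩
    refine ⟨a + a', b + b', ?_, ?_, fun i => ?_⟩
    · simp [h₁, h₁', Finset.sum_add_distrib]
    · rw [koszulCurl_add, ← h₂, ← h₂']
      funext i
      simp
    · simp [h₃, h₃']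
  zero_mem' := ⟨0, 0, by simp, by funext i; fin_cases i <;> simp [koszulCurl], by simp⟩
  smul_mem' := by
    rintro f x ⟨a, b, h₁, h₂, h₃⟩
    refine ⟨f • a, f • b, ?_, ?_, fun i => ?_⟩
    · simp [h₁, Finset.smul_sum, smul_comm f]
    · rw [koszulCurl_smul, ← h₂]
      funext i
      simp
    · simp [h₃, smul_comm f]

variable {d₁ d₂ d₃ d₄}

/-- Every cycle of `P ⊗ k` at `P₃` starts a zigzag, because `P₁` and `P₀` are Koszul exact. -/
theorem exists_koszulZigzag_right (hP₀ : KoszulExact k P₀) (hP₁ : KoszulExact k P₁)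
    (h₁₂ : ∀ x, d₁ (d₂ x) = 0) (h₂₃ : ∀ x, d₂ (d₃ x) = 0) {z : P₃}
    (hz : d₃ z ∈ maxIdeal k • (⊤ : Submodule (PolyRing k) P₂)) :
    ∃ c, (z, c) ∈ koszulZigzag d₁ d₂ d₃ := by
  obtain ⟨a, ha⟩ := mem_maxIdeal_smul_top_iff_exists.1 hz
  obtain ⟨b, hb⟩ := hP₁.exists_curl (fun i => d₂ (a i)) (by
    rw [← h₂₃ z, ha]; simp)
  obtain ⟨c, hc⟩ := hP₀.exists_smul (fun i => d₁ (b i)) (by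
    funext i
    rw [← map_koszulCurl, ← hb, h₁₂]; rfl)
  exact ⟨c, a, b, ha, hb, hc⟩

/-- Every element of `P₀` that `𝔪` maps into the image of `P₁` ends a zigzag, because `P` is exact. -/
theorem exists_koszulZigzag_left (h₁₂ : LinearMap.ker d₁ = LinearMap.range d₂)
    (h₂₃ : LinearMap.ker d₂ = LinearMap.range d₃) {c : P₀}
    (hc : ∀ i, (X i : PolyRing k) • c ∈ LinearMap.range d₁) :
    ∃ z, (z, c) ∈ koszulZigzag d₁ d₂ d₃ := by
  choose b hb using hc
  have (i : Fin 3) : koszulCurl k b i ∈ LinearMap.range d₂ := by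
    rw [← h₁₂, LinearMap.mem_ker, map_koszulCurl, funext hb, koszulCurl_X_smul]; rfl
  choose a ha using this
  have : ∑ i, (X i : PolyRing k) • a i ∈ LinearMap.range d₃ := by
    rw [← h₂₃, LinearMap.mem_ker]
    simp only [map_sum, map_smul, ha, sum_X_smul_koszulCurl]
  obtain ⟨z, hz⟩ := this
  exact ⟨z, a, b, hz, funext ha, hb⟩

/-- A zigzag that starts in a boundary of `P ⊗ k` ends in the image of `P₁`. -/
theorem mem_range_of_koszulZigzag (hP₁ : KoszulExact k P₁) (hP₂ : KoszulExact k P₂)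
    (h₁₂ : ∀ x, d₁ (d₂ x) = 0) (h₂₃ : ∀ x, d₂ (d₃ x) = 0)
    (h₃₄ : ∀ x, d₃ (d₄ x) = 0)
    (hreg : ∀ c c' : P₀, (X 0 : PolyRing k) • c = (X 0 : PolyRing k) • c' → c = c')
    {z : P₃} {c : P₀} (h : (z, c) ∈ koszulZigzag d₁ d₂ d₃)
    (hz : z ∈ LinearMap.range d₄ ⊔ maxIdeal k • ⊤) : c ∈ LinearMap.range d₁ := by
  obtain ⟨a, b, ha, hb, hc⟩ := h
  obtain ⟨_, ⟨w, rfl⟩, v, hv, rfl⟩ := Submodule.mem_sup.1 hz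
  obtain ⟨y, rfl⟩ := mem_maxIdeal_smul_top_iff_exists.1 hv
  obtain ⟨a', ha'⟩ := hP₂.exists_curl (fun i => a i - d₃ (y i)) (by
    simp only [smul_sub, Finset.sum_sub_distrib, ← ha]
    simp [h₃₄])
  obtain ⟨c', hc'⟩ := hP₁.exists_smul (b - fun i => d₂ (a' i)) (by
    rw [koszulCurl_sub, ← hb]
    funext i
    rw [Pi.sub_apply, ← map_koszulCurl, ← ha', map_sub, h₂₃]
    simp)
  refine ⟨c', hreg _ _ ?_⟩
  rw [← map_smul, ← hc', ← hc 0]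
  simp [h₁₂]

/-- A zigzag that ends in the image of `P₁` starts in a boundary of `P ⊗ k`. -/
theorem mem_sup_of_koszulZigzag (h₁₂ : LinearMap.ker d₁ = LinearMap.range d₂)
    (h₂₃ : LinearMap.ker d₂ = LinearMap.range d₃) (h₃₄ : LinearMap.ker d₃ = LinearMap.range d₄)
    {z : P₃} {c : P₀} (h : (z, c) ∈ koszulZigzag d₁ d₂ d₃) (hc : c ∈ LinearMap.range d₁) :
    z ∈ LinearMap.range d₄ ⊔ maxIdeal k • ⊤ := by
  obtain ⟨a, b, ha, hb, hbc⟩ := h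
  obtain ⟨c', rfl⟩ := hc
  have (i : Fin 3) : b i - (X i : PolyRing k) • c' ∈ LinearMap.range d₂ := by
    rw [← h₁₂, LinearMap.mem_ker, map_sub, hbc, map_smul, sub_self]
  choose a' ha' using this
  have (i : Fin 3) : a i - koszulCurl k a' i ∈ LinearMap.range d₃ := by
    rw [← h₂₃, LinearMap.mem_ker, map_sub, map_koszulCurl, funext ha', congrFun hb i]
    change koszulCurl k b i - koszulCurl k (b - fun i => (X i : PolyRing k) • c') i = 0
    rw [koszulCurl_sub, koszulCurl_X_smul, sub_zero, sub_self]
  choose y hy using this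
  have : z - ∑ i, (X i : PolyRing k) • y i ∈ LinearMap.range d₄ := by
    rw [← h₃₄, LinearMap.mem_ker, map_sub, ha]
    simp only [map_sum, map_smul, hy, smul_sub, Finset.sum_sub_distrib, sum_X_smul_koszulCurl]
    simp
  refine Submodule.mem_sup.2 ⟨_, this, _, mem_maxIdeal_smul_top_iff_exists.2 ⟨y, rfl⟩, ?_⟩
  abel

end Zigzag

end Koszul

/-! ### The homology of `G ⊗ k` and the socle of `T / J` -/

theorem finrank_eq_of_ker_eq {k Q V W : Type*} [Field k] [AddCommGroup Q] [Module k Q]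
    [AddCommGroup V] [Module k V] [AddCommGroup W] [Module k W] (f : Q →ₗ[k] V) (g : Q →ₗ[k] W)
    (hf : Function.Surjective f) (hg : Function.Surjective g)
    (h : LinearMap.ker f = LinearMap.ker g) : Module.finrank k V = Module.finrank k W :=
  (((f.quotKerEquivOfSurjective hf).symm.trans (Submodule.quotEquivOfEq _ _ h)).trans
    (g.quotKerEquivOfSurjective hg)).finrank_eq

section Projections

variable {k : Type*} [Field k]

theorem freeComp_koszulCurl {r : ℕ} (e : Fin r → ℤ) (q : ℤ) (b : Fin 3 → Fin r → PolyRing k)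
    (i : Fin 3) :
    freeComp e (q + 1) (koszulCurl k b i) = koszulCurl k (fun j => freeComp e q (b j)) i := by
  fin_cases i <;> simp [koszulCurl, freeComp_X_smul]

theorem freeComp_mem_maxIdeal_smul_top {r : ℕ} {e : Fin r → ℤ} (q : ℤ) {v : Fin r → PolyRing k}
    (hv : v ∈ maxIdeal k • (⊤ : Submodule (PolyRing k) (Fin r → PolyRing k))) :
    freeComp e q v ∈ maxIdeal k • (⊤ : Submodule (PolyRing k) (Fin r → PolyRing k)) := by
  rw [mem_maxIdeal_smul_top_iff] at hv ⊢
  intro j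
  rw [freeComp_apply, constantCoeff_eq, coeff_polyComp, ← constantCoeff_eq, hv, ite_self]

/-- The forms of degree `q` that represent socle elements of `T / J`. -/
noncomputable def socleForms (J : Ideal (PolyRing k)) (q : ℤ) : Submodule k (PolyRing k) :=
  polyPiece k q ⊓ ⨅ i : Fin 3, (J.restrictScalars k).comap (LinearMap.mulLeft k (X i))

theorem mem_socleForms {J : Ideal (PolyRing k)} {q : ℤ} {c : PolyRing k} :
    c ∈ socleForms J q ↔ c ∈ polyPiece k q ∧ ∀ i : Fin 3, X i * c ∈ J := by
  simp [socleForms]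

theorem inf_polyPiece_le_socleForms (J : Ideal (PolyRing k)) (q : ℤ) :
    J.restrictScalars k ⊓ polyPiece k q ≤ socleForms J q :=
  fun _ hc => mem_socleForms.2 ⟨hc.2, fun _ => J.mul_mem_left _ hc.1⟩

instance (J : Ideal (PolyRing k)) (q : ℤ) : FiniteDimensional k (socleForms J q) :=
  Submodule.finiteDimensional_of_le (inf_le_left (a := polyPiece k q))

/-- Multiplication by `s` embeds `V` into the forms of degree `q + 1` of `J`. -/
theorem finrank_le_hilbertFn_of_mul_mem {J : Ideal (PolyRing k)} {q : ℤ}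
    {V : Submodule k (PolyRing k)} (hV : V ≤ polyPiece k q) (h : ∀ c ∈ V, X 0 * c ∈ J) :
    Module.finrank k V ≤ hilbertFn J (q + 1) := by
  have : FiniteDimensional k ↥(J.restrictScalars k ⊓ polyPiece k (q + 1)) :=
    Submodule.finiteDimensional_of_le inf_le_right
  refine LinearMap.finrank_le_finrank_of_injective
    (f := (LinearMap.mulLeft k (X 0 : PolyRing k)).restrict (p := V)
      (q := J.restrictScalars k ⊓ polyPiece k (q + 1)) fun c hc =>
        ⟨h c hc, add_comm 1 q ▸ mul_mem_polyPiece (X_mem_polyPiece 0) (hV hc)⟩) ?_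
  intro c c' hcc
  have := congrArg Subtype.val hcc
  exact Subtype.ext (mul_left_cancel₀ (X_ne_zero (R := k) (0 : Fin 3)) this)

theorem hilbertFn_mono (J : Ideal (PolyRing k)) : Monotone (hilbertFn J) :=
  monotone_int_of_le_succ fun _ =>
    finrank_le_hilbertFn_of_mul_mem inf_le_right fun _ hc => J.mul_mem_left _ hc.1

theorem finrank_socle_add_hilbertFn_le (J : Ideal (PolyRing k)) (q : ℤ) :
    Module.finrank k (↥(socleForms J q) ⧸
      (J.restrictScalars k ⊓ polyPiece k q).submoduleOf (socleForms J q)) + hilbertFn J q ≤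
      hilbertFn J (q + 1) := by
  have h := Submodule.finrank_quotient_add_finrank
    ((J.restrictScalars k ⊓ polyPiece k q).submoduleOf (socleForms J q))
  rw [(Submodule.submoduleOfEquivOfLe (inf_polyPiece_le_socleForms J q)).finrank_eq] at h
  rw [hilbertFn, h]
  exact finrank_le_hilbertFn_of_mul_mem inf_le_left fun c hc => (mem_socleForms.1 hc).2 0

end Projections

namespace GradedFreeResolution

variable {k : Type*} [Field k] {J : Ideal (PolyRing k)} (G : GradedFreeResolution J)

theorem aug_d (x) : G.aug (G.d 0 x) = 0 :=
  LinearMap.mem_ker.1 (G.exact_zero ▸ LinearMap.mem_range_self _ x)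

theorem mem_range_aug_iff {c : PolyRing k} : c ∈ LinearMap.range G.aug ↔ c ∈ J :=
  SetLike.ext_iff.1 G.range_aug c

theorem d_d (i : ℕ) (x) : G.d i (G.d (i + 1) x) = 0 :=
  LinearMap.mem_ker.1 (G.exact_succ i ▸ LinearMap.mem_range_self _ x)

theorem tensorD_toTensor (i : ℕ) (z) :
    G.tensorD i (G.toTensor (i + 1) z) = G.toTensor i (G.d i z) :=
  LinearMap.rTensor_tmul _ _ _ _

theorem toTensor_eq_zero_iff (i : ℕ) (z) :
    G.toTensor i z = 0 ↔
      z ∈ maxIdeal k • (⊤ : Submodule (PolyRing k) (Fin (G.rank i) → PolyRing k)) := by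
  rw [← Submodule.Quotient.mk_eq_zero,
    ← map_eq_zero_iff _ (TensorProduct.tensorQuotEquivQuotSMul _ (maxIdeal k)).symm.injective,
    TensorProduct.tensorQuotEquivQuotSMul_symm_mk]
  rfl

theorem toTensor_mem_cycles_iff (i : ℕ) {p : ℤ} {z} (hz : z ∈ freePiece (G.deg (i + 1)) p) :
    G.toTensor (i + 1) z ∈ G.cycles (i + 1) p ↔
      G.d i z ∈ maxIdeal k • (⊤ : Submodule (PolyRing k) (Fin (G.rank i) → PolyRing k)) := by
  rw [← toTensor_eq_zero_iff, ← tensorD_toTensor]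
  exact ⟨fun h => h.1, fun h => ⟨h, z, hz, rfl⟩⟩

theorem toTensor_mem_boundaries_iff (i : ℕ) {p : ℤ} {z} (hz : z ∈ freePiece (G.deg i) p) :
    G.toTensor i z ∈ G.boundaries i p ↔ z ∈ LinearMap.range (G.d i) ⊔ maxIdeal k • ⊤ := by
  constructor
  · rintro ⟨_, ⟨w, -, rfl⟩, h⟩
    rw [tensorD_toTensor] at h
    refine Submodule.mem_sup.2 ⟨_, ⟨w, rfl⟩, z - G.d i w, ?_, by abel⟩
    rw [← toTensor_eq_zero_iff, map_sub, h, sub_self]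
  · intro h
    obtain ⟨_, ⟨w, rfl⟩, v, hv, h⟩ := Submodule.mem_sup.1 h
    refine ⟨_, ⟨freeComp (G.deg (i + 1)) p w, freeComp_mem _ _ _, rfl⟩, ?_⟩
    rw [tensorD_toTensor, ← freeComp_map _ (G.d_graded i), ← sub_eq_zero, ← map_sub,
      toTensor_eq_zero_iff]
    have : freeComp (G.deg i) p (G.d i w) - z = - freeComp (G.deg i) p v := by
      conv_lhs => rw [← freeComp_of_mem hz, ← h, map_add]
      abel
    rw [this]
    exact Submodule.neg_mem _ (freeComp_mem_maxIdeal_smul_top p hv)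

/-- The homogeneous components of a zigzag form a zigzag. -/
theorem freeComp_mem_koszulZigzag (q : ℤ) {z c}
    (h : (z, c) ∈ koszulZigzag G.aug (G.d 0) (G.d 1)) :
    (freeComp (G.deg 2) (q + 3) z, polyComp k q c) ∈ koszulZigzag G.aug (G.d 0) (G.d 1) := by
  obtain ⟨a, b, ha, hb, hc⟩ := h
  refine ⟨fun i => freeComp (G.deg 1) (q + 2) (a i), fun i => freeComp (G.deg 0) (q + 1) (b i),
    ?_, funext fun i => ?_, fun i => ?_⟩
  · change G.d 1 (freeComp _ _ z) = _
    rw [← freeComp_map _ (G.d_graded 1), ha, map_sum, show q + 3 = q + 2 + 1 by ring]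
    simp only [freeComp_X_smul]
  · rw [← freeComp_map _ (G.d_graded 0), congrFun hb i, show q + 2 = q + 1 + 1 by ring,
      freeComp_koszulCurl]
  · rw [← polyComp_map _ G.aug_graded, hc, smul_eq_mul, polyComp_X_mul, smul_eq_mul]

/-- `Tor₂(J, k)` is the socle of `T / J`, with degrees raised by three. -/
theorem finrank_torPiece_two (q : ℤ) :
    Module.finrank k (G.TorPiece 2 (q + 3)) = Module.finrank k (↥(socleForms J q) ⧸
      (J.restrictScalars k ⊓ polyPiece k q).submoduleOf (socleForms J q)) := by
  let Q : Submodule k ((Fin (G.rank 2) → PolyRing k) × PolyRing k) :=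
    (koszulZigzag G.aug (G.d 0) (G.d 1)).restrictScalars k ⊓
      (freePiece (G.deg 2) (q + 3)).prod (polyPiece k q)
  have hQ₁ (x : Q) : G.toTensor 2 x.1.1 ∈ G.cycles 2 (q + 3) := by
    obtain ⟨⟨z, c⟩, ⟨a, b, ha, -⟩, hz, -⟩ := x
    exact (G.toTensor_mem_cycles_iff 1 hz).2 (mem_maxIdeal_smul_top_iff_exists.2 ⟨a, ha⟩)
  have hQ₂ (x : Q) : x.1.2 ∈ socleForms J q := by
    obtain ⟨⟨z, c⟩, ⟨a, b, -, -, hc⟩, -, hcq⟩ := x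
    exact mem_socleForms.2 ⟨hcq, fun i => G.mem_range_aug_iff.1 ⟨b i, hc i⟩⟩
  refine finrank_eq_of_ker_eq
    ((Submodule.mkQ _).comp
      (((G.toTensor 2).comp ((LinearMap.fst k _ _).comp Q.subtype)).codRestrict _ hQ₁))
    ((Submodule.mkQ _).comp (((LinearMap.snd k _ _).comp Q.subtype).codRestrict _ hQ₂))
    ?_ ?_ ?_
  · refine (Submodule.mkQ_surjective _).comp ?_
    rintro ⟨y, hy⟩
    obtain ⟨z, hz, rfl⟩ := hy.2
    obtain ⟨c, hzc⟩ := exists_koszulZigzag_right koszulExact_polyRing koszulExact_pi G.aug_d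
      (G.d_d 0) ((G.toTensor_mem_cycles_iff 1 hz).1 hy)
    have h := G.freeComp_mem_koszulZigzag q hzc
    rw [freeComp_of_mem hz] at h
    exact ⟨⟨(z, polyComp k q c), h, hz, polyComp_mem q c⟩, rfl⟩
  · refine (Submodule.mkQ_surjective _).comp ?_
    rintro ⟨c, hc⟩
    obtain ⟨hcq, hcJ⟩ := mem_socleForms.1 hc
    obtain ⟨z, hzc⟩ := exists_koszulZigzag_left G.exact_zero (G.exact_succ 0)
      (c := c) (fun i => G.mem_range_aug_iff.2 (hcJ i))
    have h := G.freeComp_mem_koszulZigzag q hzc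
    rw [polyComp_of_mem hcq] at h
    exact ⟨⟨(_, c), h, freeComp_mem _ _ z, hcq⟩, rfl⟩
  · ext x
    obtain ⟨⟨z, c⟩, hzc, hz, hc⟩ := x
    rw [LinearMap.mem_ker, LinearMap.mem_ker]
    simp only [LinearMap.comp_apply, Submodule.mkQ_apply, Submodule.Quotient.mk_eq_zero]
    change G.toTensor 2 z ∈ G.boundaries 2 (q + 3) ↔ c ∈ J ∧ c ∈ polyPiece k q
    rw [G.toTensor_mem_boundaries_iff 2 hz, and_iff_left (show c ∈ polyPiece k q from hc),
      ← G.mem_range_aug_iff]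
    exact ⟨mem_range_of_koszulZigzag koszulExact_pi koszulExact_pi G.aug_d (G.d_d 0) (G.d_d 1)
      (fun _ _ => mul_left_cancel₀ (X_ne_zero (R := k) (0 : Fin 3))) hzc,
      mem_sup_of_koszulZigzag G.exact_zero (G.exact_succ 0) (G.exact_succ 1) hzc⟩

variable {G}

theorem IsMinimal.constantCoeff_d (hG : G.IsMinimal) (i : ℕ) (z) (j) :
    constantCoeff (G.d i z j) = 0 :=
  mem_maxIdeal_smul_top_iff.1 (hG i (LinearMap.mem_range_self _ z)) j

/-- In a minimal resolution all differentials of `F ⊗ k` vanish, so that `Tor` counts the summands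
of the terms. -/
theorem IsMinimal.finrank_torPiece_succ (hG : G.IsMinimal) (i : ℕ) (p : ℤ) :
    Module.finrank k (G.TorPiece (i + 1) p) = G.gradedBetti (i + 1) p := by
  have hcyc (z : freePiece (k := k) (G.deg (i + 1)) p) :
      G.toTensor (i + 1) z ∈ G.cycles (i + 1) p :=
    (G.toTensor_mem_cycles_iff i z.2).2 (hG i (LinearMap.mem_range_self _ _))
  have hL (z : freePiece (k := k) (G.deg (i + 1)) p) (j) (hj : G.deg (i + 1) j ≠ p) :
      constantCoeff (z.1 j) = 0 :=
    constantCoeff_eq_zero_of_mem_polyPiece (sub_ne_zero.2 hj.symm) (mem_freePiece.1 z.2 j)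
  let L : freePiece (k := k) (G.deg (i + 1)) p →ₗ[k]
      ({j // G.deg (i + 1) j = p} → k) :=
    LinearMap.pi fun j => (lcoeff k (0 : Fin 3 →₀ ℕ)).comp
      (((LinearMap.proj j.1 : (Fin (G.rank (i + 1)) → PolyRing k) →ₗ[k] PolyRing k)).comp
        (Submodule.subtype _))
  have hLa (z j) : L z j = constantCoeff (z.1 j.1) := rfl
  rw [finrank_eq_of_ker_eq ((Submodule.mkQ _).comp
    (((G.toTensor (i + 1)).comp (Submodule.subtype _)).codRestrict _ hcyc)) L ?_ ?_ ?_]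
  · rw [Module.finrank_fintype_fun_eq_card, Fintype.card_subtype]
    rfl
  · refine (Submodule.mkQ_surjective _).comp ?_
    rintro ⟨y, hy⟩
    obtain ⟨z, hz, rfl⟩ := hy.2
    exact ⟨⟨z, hz⟩, rfl⟩
  · intro w
    refine ⟨⟨fun j => if h : G.deg (i + 1) j = p then C (w ⟨j, h⟩) else 0,
      mem_freePiece.2 fun j => ?_⟩, funext fun j => ?_⟩
    · split_ifs with h
      · rw [h, sub_self]
        exact C_mem_polyPiece _
      · exact Submodule.zero_mem _
    · rw [hLa]
      simp [j.2]
  · ext z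
    rw [LinearMap.mem_ker, LinearMap.mem_ker]
    simp only [LinearMap.comp_apply, Submodule.mkQ_apply, Submodule.Quotient.mk_eq_zero]
    change G.toTensor (i + 1) z ∈ G.boundaries (i + 1) p ↔ _
    rw [G.toTensor_mem_boundaries_iff _ z.2, sup_eq_right.2 (hG (i + 1)),
      mem_maxIdeal_smul_top_iff]
    constructor
    · exact fun h => funext fun j => h j
    · intro h j
      by_cases hj : G.deg (i + 1) j = p
      · exact congrFun h ⟨j, hj⟩
      · exact hL z j hj

end GradedFreeResolution

/-! ### Existence of minimal graded free resolutions -/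

theorem IsProjectionFamily.exists_eq_sum {k M : Type*} [Field k] [AddCommGroup M] [Module k M]
    {𝒜 : ℤ → Submodule k M} {π : ℤ → M →ₗ[k] M} (hπ : IsProjectionFamily 𝒜 π) (v : M) :
    ∃ s : Finset ℤ, ∀ t, s ⊆ t → v = ∑ q ∈ t, π q v := by
  have hv : v ∈ ⨆ q, 𝒜 q := hπ.iSup_eq_top ▸ Submodule.mem_top
  induction hv using Submodule.iSup_induction' with
  | mem q v hv =>
    refine ⟨{q}, fun t ht => ?_⟩
    rw [Finset.sum_eq_single_of_mem q (ht (Finset.mem_singleton_self q))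
      fun q' _ hq' => hπ.apply_of_ne hv hq', hπ.apply_self hv]
  | zero => exact ⟨∅, fun t _ => by simp⟩
  | add x y _ _ hx hy =>
    obtain ⟨s, hs⟩ := hx
    obtain ⟨s', hs'⟩ := hy
    refine ⟨s ∪ s', fun t ht => ?_⟩
    simp only [map_add, Finset.sum_add_distrib]
    rw [← hs t (Finset.union_subset_left ht), ← hs' t (Finset.union_subset_right ht)]

section Existence

variable {k : Type*} [Field k]

/-- A homogeneous map of degree zero from a graded free module of finite rank onto a graded
submodule `N` of `⨁ j, T(-e j)` that sends the basis to a minimal system of generators of `N`. -/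
structure MinimalCover {r : ℕ} (e : Fin r → ℤ) (N : Submodule (PolyRing k) (Fin r → PolyRing k))
    where
  rank : ℕ
  deg : Fin rank → ℤ
  map : (Fin rank → PolyRing k) →ₗ[PolyRing k] (Fin r → PolyRing k)
  map_mem : ∀ p, ∀ v ∈ freePiece deg p, map v ∈ freePiece e p
  range_map : LinearMap.range map = N
  ker_map_le : LinearMap.ker map ≤
    maxIdeal k • (⊤ : Submodule (PolyRing k) (Fin rank → PolyRing k))

theorem linearCombination_mem_freePiece {r n : ℕ} {e : Fin r → ℤ} {e' : Fin n → ℤ}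
    {g : Fin n → Fin r → PolyRing k} {a : ℤ} (hg : ∀ i, g i ∈ freePiece e (e' i + a)) {p : ℤ}
    {v : Fin n → PolyRing k} (hv : v ∈ freePiece e' p) :
    Fintype.linearCombination (PolyRing k) g v ∈ freePiece e (p + a) := by
  rw [Fintype.linearCombination_apply]
  refine Submodule.sum_mem _ fun i _ => mem_freePiece.2 fun j => ?_
  have := mul_mem_polyPiece (mem_freePiece.1 hv i) (mem_freePiece.1 (hg i) j)
  rwa [show p - e' i + (e' i + a - e j) = p + a - e j by ring] at this

theorem exists_homogeneous_generators {r : ℕ} (e : Fin r → ℤ)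
    (N : Submodule (PolyRing k) (Fin r → PolyRing k))
    (hN : ∀ p, ∀ v ∈ N, freeComp e p v ∈ N) :
    ∃ (n : ℕ) (e' : Fin n → ℤ) (g : Fin n → Fin r → PolyRing k),
      (∀ i, g i ∈ freePiece e (e' i)) ∧ Submodule.span (PolyRing k) (Set.range g) = N := by
  set H : Set (Fin r → PolyRing k) := {v | v ∈ N ∧ ∃ p, v ∈ freePiece e p} with hH
  have hspan : Submodule.span (PolyRing k) H = N := by
    refine le_antisymm (Submodule.span_le.2 fun v hv => hv.1) fun v hv => ?_
    obtain ⟨s, hs⟩ := (freeComp_isProjectionFamily e).exists_eq_sum v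
    rw [hs s subset_rfl]
    exact Submodule.sum_mem _ fun q _ =>
      Submodule.subset_span ⟨hN q v hv, q, freeComp_mem e q v⟩
  obtain ⟨s, hsH, hs⟩ := Submodule.fg_span_iff_fg_span_finset_subset H |>.1
    (IsNoetherian.noetherian (Submodule.span (PolyRing k) H))
  have (i : Fin s.card) := (hsH (s.equivFin.symm i).2).2
  choose e' he' using this
  refine ⟨s.card, e', fun i => s.equivFin.symm i, he', ?_⟩
  rw [← hspan, hs]
  congr 1
  ext v
  constructor
  · rintro ⟨i, rfl⟩
    exact (s.equivFin.symm i).2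
  · intro hv
    exact ⟨s.equivFin ⟨v, hv⟩, by simp⟩

/-- A shortest system of homogeneous generators is minimal: a relation with a nonzero constant
coefficient has a homogeneous component in which that coefficient is a unit, and this makes a
generator superfluous. -/
theorem nonempty_minimalCover {r : ℕ} (e : Fin r → ℤ)
    (N : Submodule (PolyRing k) (Fin r → PolyRing k))
    (hN : ∀ p, ∀ v ∈ N, freeComp e p v ∈ N) : Nonempty (MinimalCover e N) := by
  classical
  have hex := exists_homogeneous_generators e N hN
  obtain ⟨e', g, hg, hspan⟩ := Nat.find_spec hex
  have hmin := fun m => Nat.find_min hex (m := m)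
  generalize Nat.find hex = n at e' g hg hspan hmin
  have hmem (p) (v) (hv : v ∈ freePiece e' p) :
      Fintype.linearCombination (PolyRing k) g v ∈ freePiece e p := by
    simpa using linearCombination_mem_freePiece (a := 0) (by simpa using hg) hv
  refine ⟨⟨n, e', Fintype.linearCombination (PolyRing k) g, hmem, ?_, fun v hv => ?_⟩⟩
  · rw [Fintype.range_linearCombination, hspan]
  · rw [mem_maxIdeal_smul_top_iff]
    intro j
    by_contra hj
    have hw := freeComp_map (e := e') (e' := e) _ hmem (e' j) v
    rw [LinearMap.mem_ker.1 hv, map_zero] at hw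
    set w := freeComp e' (e' j) v with hw'
    have hwj : w j = C (constantCoeff (v j)) := by
      rw [hw', freeComp_apply, sub_self, polyComp_zero_eq]
    obtain ⟨m, rfl⟩ : ∃ m, n = m + 1 := Nat.exists_eq_succ_of_ne_zero (by
      rintro rfl
      exact j.elim0)
    refine hmin m (Nat.lt_succ_self m)
      ⟨fun i => e' (j.succAbove i), fun i => g (j.succAbove i), fun i => hg _, ?_⟩
    refine le_antisymm ?_ ?_
    · rw [← hspan]
      exact Submodule.span_mono (by rintro _ ⟨i, rfl⟩; exact ⟨_, rfl⟩)
    · rw [← hspan, Submodule.span_le]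
      rintro _ ⟨i, rfl⟩
      rcases Fin.eq_self_or_eq_succAbove j i with rfl | ⟨i, rfl⟩
      · rw [Fintype.linearCombination_apply, Fin.sum_univ_succAbove _ i, hwj] at hw
        have : g i = (C (constantCoeff (v i))⁻¹ : PolyRing k) •
            (-∑ l, w (i.succAbove l) • g (i.succAbove l)) := by
          rw [← eq_neg_of_add_eq_zero_left hw.symm, smul_smul, ← C_mul, inv_mul_cancel₀ hj, C_1,
            one_smul]
        rw [this]
        exact Submodule.smul_mem _ _ (Submodule.neg_mem _ (Submodule.sum_mem _ fun l _ =>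
          Submodule.smul_mem _ _ (Submodule.subset_span ⟨l, rfl⟩)))
      · exact Submodule.subset_span ⟨i, rfl⟩

/-- A graded submodule of a graded free module `⨁ j, T(-deg j)` of finite rank. -/
structure GradedSubmodule (k : Type*) [Field k] where
  rank : ℕ
  deg : Fin rank → ℤ
  carrier : Submodule (PolyRing k) (Fin rank → PolyRing k)
  freeComp_mem : ∀ p, ∀ v ∈ carrier, freeComp deg p v ∈ carrier

namespace GradedSubmodule

/-- A chosen minimal cover of a graded submodule. -/
noncomputable def cover (N : GradedSubmodule k) : MinimalCover N.deg N.carrier :=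
  (nonempty_minimalCover N.deg N.carrier N.freeComp_mem).some

/-- The first syzygy module of a graded submodule. -/
noncomputable def syzygy (N : GradedSubmodule k) : GradedSubmodule k where
  rank := N.cover.rank
  deg := N.cover.deg
  carrier := LinearMap.ker N.cover.map
  freeComp_mem p v hv := by
    rw [LinearMap.mem_ker, ← freeComp_map _ N.cover.map_mem, LinearMap.mem_ker.1 hv, map_zero]

/-- The `(i + 1)`-st syzygy module of a graded submodule. -/
noncomputable def iterSyzygy (N : GradedSubmodule k) : ℕ → GradedSubmodule k
  | 0 => N.syzygy
  | i + 1 => (N.iterSyzygy i).syzygy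

/-- A homogeneous ideal as a graded submodule of the free module `T¹`. -/
noncomputable def ofIdeal (J : Ideal (PolyRing k))
    (hJ : J.IsHomogeneous (homogeneousSubmodule (Fin 3) k)) : GradedSubmodule k where
  rank := 1
  deg := 0
  carrier := Submodule.comap (LinearMap.proj 0) J
  freeComp_mem _ _ hv := polyComp_mem_of_isHomogeneous hJ hv _

end GradedSubmodule

theorem exists_isMinimal {J : Ideal (PolyRing k)}
    (hJ : J.IsHomogeneous (homogeneousSubmodule (Fin 3) k)) :
    ∃ F : GradedFreeResolution J, F.IsMinimal := by
  let N := GradedSubmodule.ofIdeal J hJ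
  let M : MinimalCover (r := 1) 0 (Submodule.comap (LinearMap.proj 0) J) := N.cover
  let F : GradedFreeResolution J :=
    { rank := fun i => (N.iterSyzygy i).rank
      deg := fun i => (N.iterSyzygy i).deg
      d := fun i => (N.iterSyzygy i).cover.map
      aug := (LinearMap.proj (0 : Fin 1)).comp N.cover.map
      d_graded := fun i => (N.iterSyzygy i).cover.map_mem
      aug_graded := fun p v hv => by
        have := mem_freePiece.1 (N.cover.map_mem p v hv) (0 : Fin 1)
        rwa [show N.deg (0 : Fin 1) = 0 from rfl, sub_zero] at this
      range_aug := by
        change LinearMap.range ((LinearMap.proj 0).comp M.map) = J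
        rw [LinearMap.range_comp, M.range_map]
        exact Submodule.map_comap_eq_of_surjective (fun c => ⟨fun _ => c, rfl⟩) _
      exact_zero := by
        refine Eq.trans ?_ (N.iterSyzygy 0).cover.range_map.symm
        refine Submodule.ext fun v => ⟨fun h => funext fun i => ?_, fun h => ?_⟩
        · obtain rfl : i = (0 : Fin 1) := Subsingleton.elim (α := Fin 1) _ _
          exact h
        · exact congrFun h (0 : Fin 1)
      exact_succ := fun i => (N.iterSyzygy (i + 1)).cover.range_map.symm }
  refine ⟨F, fun i => ?_⟩
  refine (N.iterSyzygy i).cover.range_map.le.trans ?_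
  cases i with
  | zero => exact N.cover.ker_map_le
  | succ i => exact (N.iterSyzygy i).cover.ker_map_le

end Existence

/-! ### Length of a minimal resolution and the bound for the last Betti number -/

theorem eq_zero_of_top_le_maxIdeal_smul_top {k : Type*} [Field k] {r : ℕ}
    (h : ∀ z : Fin r → PolyRing k, z ∈ maxIdeal k • (⊤ : Submodule (PolyRing k) _)) : r = 0 := by
  by_contra hr
  simpa using mem_maxIdeal_smul_top_iff.1 (h 1) ⟨0, Nat.pos_of_ne_zero hr⟩

theorem hilbertFn_of_neg {k : Type*} [Field k] (J : Ideal (PolyRing k)) {q : ℤ} (hq : q < 0) :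
    hilbertFn J q = 0 := by
  have : J.restrictScalars k ⊓ polyPiece k q = ⊥ :=
    eq_bot_iff.2 fun f hf => eq_zero_of_mem_polyPiece_of_neg hq hf.2
  rw [hilbertFn, this, finrank_bot]

namespace GradedFreeResolution

variable {k : Type*} [Field k] {J : Ideal (PolyRing k)} {F : GradedFreeResolution J}

/-- `Tor₃(J, k) = 0`: a zigzag that starts in `F 3` ends in an element `c` of `F 0` with
`s * aug c = 0`. -/
theorem IsMinimal.rank_three (hF : F.IsMinimal) : F.rank 3 = 0 := by
  refine eq_zero_of_top_le_maxIdeal_smul_top (k := k) fun z => ?_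
  obtain ⟨c, hzc⟩ := exists_koszulZigzag_right koszulExact_pi koszulExact_pi (F.d_d 0) (F.d_d 1)
    (z := z) (hF 2 (LinearMap.mem_range_self _ _))
  have hc : c ∈ LinearMap.range (F.d 0) := by
    obtain ⟨a, b, -, -, hb⟩ := hzc
    have h := congrArg F.aug (hb 0)
    rw [F.aug_d, map_smul, smul_eq_mul, eq_comm] at h
    rw [← F.exact_zero]
    exact (mul_eq_zero.1 h).resolve_left (X_ne_zero _)
  have h := mem_sup_of_koszulZigzag (F.exact_succ 0) (F.exact_succ 1) (F.exact_succ 2) hzc hc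
  rwa [sup_eq_right.2 (hF 3)] at h

theorem IsMinimal.rank_eq_zero (hF : F.IsMinimal) {i : ℕ} (hi : 3 ≤ i) : F.rank i = 0 := by
  induction i, hi using Nat.le_induction with
  | base => exact hF.rank_three
  | succ i _ ih =>
    refine eq_zero_of_top_le_maxIdeal_smul_top (k := k) fun z => hF (i + 1) ?_
    rw [← F.exact_succ i, LinearMap.mem_ker]
    have : IsEmpty (Fin (F.rank i)) := by rw [ih]; infer_instance
    exact Subsingleton.elim _ _

theorem gradedBetti_ne_zero_iff {i : ℕ} {p : ℤ} : F.gradedBetti i p ≠ 0 ↔ ∃ j, F.deg i j = p := by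
  simp [gradedBetti, Finset.filter_eq_empty_iff]

theorem mem_shifts_iff {q : ℤ} : q ∈ F.shifts ↔ ∃ i, ∃ j, q = F.deg i j - i := by
  simp only [shifts, Set.mem_ofPred_eq, gradedBetti_ne_zero_iff]
  constructor
  · rintro ⟨i, p, ⟨j, rfl⟩, rfl⟩
    exact ⟨i, j, rfl⟩
  · rintro ⟨i, j, rfl⟩
    exact ⟨i, _, ⟨j, rfl⟩, rfl⟩

theorem IsMinimal.finite_shifts (hF : F.IsMinimal) : F.shifts.Finite := by
  refine ((Set.finite_lt_nat 3).biUnion fun i _ =>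
    Set.finite_range fun j => F.deg i j - i).subset fun q hq => ?_
  obtain ⟨i, j, rfl⟩ := mem_shifts_iff.1 hq
  refine Set.mem_biUnion (lt_of_not_ge fun hi => ?_ : i < 3) ⟨j, rfl⟩
  exact (Fin.cast (hF.rank_eq_zero hi) j).elim0

theorem exists_aug_single_ne_zero (hJ : J ≠ ⊥) : ∃ i, F.aug (Pi.single i 1) ≠ 0 := by
  by_contra! h
  have : F.aug = 0 := LinearMap.pi_ext' fun i => LinearMap.ext_ring (h i)
  exact hJ (by rw [← F.range_aug, this, LinearMap.range_zero])

theorem IsMinimal.isGreatest_reg (hF : F.IsMinimal) (hJ : J ≠ ⊥) : IsGreatest F.shifts F.reg := by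
  obtain ⟨i, -⟩ := F.exists_aug_single_ne_zero hJ
  exact ⟨Int.csSup_mem ⟨_, mem_shifts_iff.2 ⟨0, i, rfl⟩⟩ hF.finite_shifts.bddAbove,
    fun q hq => le_csSup hF.finite_shifts.bddAbove hq⟩

theorem IsMinimal.gradedBetti_two_add_hilbertFn_le (hF : F.IsMinimal) (q : ℤ) :
    F.gradedBetti 2 (q + 3) + hilbertFn J q ≤ hilbertFn J (q + 1) := by
  rw [← hF.finrank_torPiece_succ, F.finrank_torPiece_two]
  exact finrank_socle_add_hilbertFn_le J q

theorem IsMinimal.two_le_deg_two (hF : F.IsMinimal) (j : Fin (F.rank 2)) : 2 ≤ F.deg 2 j := by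
  by_contra! h
  have h₁ := hF.gradedBetti_two_add_hilbertFn_le (F.deg 2 j - 3)
  rw [sub_add_cancel, hilbertFn_of_neg J (q := F.deg 2 j - 3 + 1) (by omega)] at h₁
  exact gradedBetti_ne_zero_iff.2 ⟨j, rfl⟩ (by omega : F.gradedBetti 2 (F.deg 2 j) = 0)

/-- The differences `H_J(p - 2) - H_J(p - 3)` that bound the graded Betti numbers telescope. -/
theorem IsMinimal.card_deg_two_le (hF : F.IsMinimal) {N : ℤ} (hN : -1 ≤ N) :
    (Finset.univ.filter fun j => F.deg 2 j ≤ N + 2).card ≤ hilbertFn J N := by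
  induction N, hN using Int.leInduction with
  | base =>
    rw [Finset.card_eq_zero.2]
    · exact Nat.zero_le _
    · refine Finset.filter_eq_empty_iff.2 fun j _ => ?_
      have := hF.two_le_deg_two j
      omega
  | succ N _ ih =>
    have h : (Finset.univ.filter fun j => F.deg 2 j ≤ N + 1 + 2) ⊆
        (Finset.univ.filter fun j => F.deg 2 j ≤ N + 2) ∪
          (Finset.univ.filter fun j => F.deg 2 j = N + 3) := by
      intro j
      simp only [Finset.mem_union, Finset.mem_filter_univ]
      omega
    have h₁ := (Finset.card_le_card h).trans (Finset.card_union_le _ _)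
    have h₂ := hF.gradedBetti_two_add_hilbertFn_le N
    rw [gradedBetti] at h₂
    omega

theorem IsMinimal.betti_two_le (hF : F.IsMinimal) : F.betti 2 ≤ hilbertFn J F.reg := by
  have hreg (j) : F.deg 2 j ≤ F.reg + 2 := by
    have := le_csSup hF.finite_shifts.bddAbove (mem_shifts_iff.2 ⟨2, j, rfl⟩)
    change _ ≤ F.reg at this
    push_cast at this
    omega
  rcases Nat.eq_zero_or_pos (F.rank 2) with h | h
  · rw [betti, h]
    exact Nat.zero_le _
  · have h₁ := hF.card_deg_two_le (N := F.reg) (by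
      have h₂ := hF.two_le_deg_two ⟨0, h⟩
      have h₃ := hreg ⟨0, h⟩
      omega)
    rwa [Finset.filter_true_of_mem fun j _ => hreg j, Finset.card_univ, Fintype.card_fin] at h₁

end GradedFreeResolution

/-! ### Degrees in a minimal resolution of an ideal of height at least two -/

/-- If the `f i` have no common divisor but units and `g` divides all `f i * a`, then `g ∣ a`. -/
theorem dvd_of_forall_dvd_mul {R ι : Type*} [CommRing R] [IsDomain R]
    [UniqueFactorizationMonoid R] {f : ι → R} (hf : ∀ p, (∀ i, p ∣ f i) → IsUnit p) {g : R}
    (hg : g ≠ 0) {a : R} (h : ∀ i, g ∣ f i * a) : g ∣ a := by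
  induction g using UniqueFactorizationMonoid.induction_on_prime generalizing a with
  | h₁ => exact absurd rfl hg
  | h₂ x hx => exact hx.dvd
  | h₃ g p _ hp ih =>
    obtain ⟨i, hi⟩ : ∃ i, ¬ p ∣ f i := by
      by_contra! hc
      exact hp.not_isUnit (hf p hc)
    obtain ⟨b, rfl⟩ := (hp.dvd_or_dvd ((dvd_mul_right p g).trans (h i))).resolve_left hi
    refine mul_dvd_mul_left p (ih (right_ne_zero_of_mul hg) fun i => ?_)
    have := h i
    rwa [mul_left_comm, mul_dvd_mul_iff_left hp.ne_zero] at this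

/-- A homogeneous map from a free module into the image of `d` lifts along `d` to a homogeneous
map. -/
theorem exists_homogeneous_lift {k : Type*} [Field k] {r r' r'' : ℕ} {e : Fin r → ℤ}
    {e' : Fin r' → ℤ} {e'' : Fin r'' → ℤ}
    (d : (Fin r' → PolyRing k) →ₗ[PolyRing k] (Fin r'' → PolyRing k))
    (hd : ∀ p, ∀ v ∈ freePiece e' p, d v ∈ freePiece e'' p)
    (L : (Fin r → PolyRing k) →ₗ[PolyRing k] (Fin r'' → PolyRing k)) {a : ℤ}
    (hL : ∀ p, ∀ v ∈ freePiece e p, L v ∈ freePiece e'' (p + a))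
    (hLd : ∀ v, L v ∈ LinearMap.range d) :
    ∃ h : (Fin r → PolyRing k) →ₗ[PolyRing k] (Fin r' → PolyRing k),
      (∀ v, d (h v) = L v) ∧ ∀ p, ∀ v ∈ freePiece e p, h v ∈ freePiece e' (p + a) := by
  have hbasis (j : Fin r) :
      ∃ y ∈ freePiece e' (e j + a), d y = L (Pi.single j 1) := by
    obtain ⟨y, hy⟩ := hLd (Pi.single j 1)
    refine ⟨freeComp e' (e j + a) y, freeComp_mem _ _ _, ?_⟩
    rw [← freeComp_map d hd, hy]
    exact freeComp_of_mem (hL _ _ (single_one_mem_freePiece e j))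
  choose g hg hdg using hbasis
  refine ⟨Fintype.linearCombination (PolyRing k) g, fun v => ?_,
    fun p v hv => linearCombination_mem_freePiece hg hv⟩
  refine LinearMap.congr_fun (f := d.comp (Fintype.linearCombination (PolyRing k) g)) (g := L) ?_ v
  refine LinearMap.pi_ext' fun j => LinearMap.ext_ring ?_
  simp [Fintype.linearCombination_apply_single, hdg]

namespace GradedFreeResolution

variable {k : Type*} [Field k] {J : Ideal (PolyRing k)} {F : GradedFreeResolution J}

/-- The start of a homogeneous null homotopy of multiplication by `f = aug ε`, where `ε` is the
`i`-th basis vector of `F 0`: in degree zero it sends `1` to `ε`, and `h₀`, `h₁` are its next two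
components. -/
theorem exists_homotopy (F : GradedFreeResolution J) (i : Fin (F.rank 0)) :
    ∃ (h₀ : (Fin (F.rank 0) → PolyRing k) →ₗ[PolyRing k] (Fin (F.rank 1) → PolyRing k))
      (h₁ : (Fin (F.rank 1) → PolyRing k) →ₗ[PolyRing k] (Fin (F.rank 2) → PolyRing k)),
      (∀ x, F.d 0 (h₀ x) = F.aug (Pi.single i 1) • x - F.aug x • Pi.single i 1) ∧
      (∀ x, F.d 1 (h₁ x) = F.aug (Pi.single i 1) • x - h₀ (F.d 0 x)) ∧
      (∀ p, ∀ v ∈ freePiece (F.deg 0) p, h₀ v ∈ freePiece (F.deg 1) (p + F.deg 0 i)) ∧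
      ∀ p, ∀ v ∈ freePiece (F.deg 1) p, h₁ v ∈ freePiece (F.deg 2) (p + F.deg 0 i) := by
  set f := F.aug (Pi.single i 1) with hf
  have hfi : f ∈ polyPiece k (F.deg 0 i) := F.aug_graded _ _ (single_one_mem_freePiece _ i)
  obtain ⟨h₀, hd₀, hh₀⟩ := exists_homogeneous_lift (F.d 0) (F.d_graded 0)
    (f • LinearMap.id - F.aug.smulRight (Pi.single i 1)) (e := F.deg 0) (a := F.deg 0 i)
    (fun p v hv => Submodule.sub_mem _ (by rw [add_comm p]; exact smul_mem_freePiece hfi hv)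
      (smul_mem_freePiece (F.aug_graded p v hv) (single_one_mem_freePiece _ i)))
    (fun v => by
      rw [← F.exact_zero, LinearMap.mem_ker]
      simp [← hf, mul_comm])
  obtain ⟨h₁, hd₁, hh₁⟩ := exists_homogeneous_lift (F.d 1) (F.d_graded 1)
    (f • LinearMap.id - h₀.comp (F.d 0)) (e := F.deg 1) (a := F.deg 0 i)
    (fun p v hv => Submodule.sub_mem _ (by rw [add_comm p]; exact smul_mem_freePiece hfi hv)
      (hh₀ p _ (F.d_graded 0 p v hv)))
    (fun v => by
      rw [← F.exact_succ, LinearMap.mem_ker]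
      simp [hd₀, F.aug_d])
  exact ⟨h₀, h₁, hd₀, hd₁, hh₀, hh₁⟩

/-- Suppose that the basis vectors `ε i` of `F 0` have degrees at most `d`, and let `e` be the
coordinate function of a basis vector of `F 2` of degree `> 3d`. Then `e ∘ h i ∘ h j` vanishes on
`F 0` for degree reasons, where `h i` is the null homotopy of `f i = aug (ε i)`. Therefore
`f j * e (h i x) = f i * e (h j x)`, and since the `f i` have no common divisor, `f i` divides
`e ∘ h i`. As `f i * e = e ∘ h i ∘ d`, the function `e` factors through `d`, against minimality. -/
theorem IsMinimal.deg_two_le (hF : F.IsMinimal) (hJ : J ≠ ⊥)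
    (hgcd : ∀ g : PolyRing k, (∀ i, g ∣ F.aug (Pi.single i 1)) → IsUnit g) {d : ℤ}
    (hd : ∀ i, F.deg 0 i ≤ d) (l : Fin (F.rank 2)) : F.deg 2 l ≤ 3 * d := by
  by_contra! hl
  choose h₀ h₁ hd₀ hd₁ hh₀ hh₁ using F.exists_homotopy
  set f : Fin (F.rank 0) → PolyRing k := fun i => F.aug (Pi.single i 1) with hf
  have hinj (x) (hx : F.d 1 x = 0) : x = 0 := by
    have : x ∈ LinearMap.range (F.d 2) := F.exact_succ 1 ▸ hx
    obtain ⟨y, rfl⟩ := this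
    have : IsEmpty (Fin (F.rank (2 + 1))) := by rw [hF.rank_three]; infer_instance
    rw [Subsingleton.elim y 0, map_zero]
  let α (i : Fin (F.rank 0)) : (Fin (F.rank 1) → PolyRing k) →ₗ[PolyRing k] PolyRing k :=
    (LinearMap.proj l).comp (h₁ i)
  have hα (i x) : α i x = h₁ i x l := rfl
  have hαd (i z) : α i (F.d 1 z) = f i * z l := by
    have : h₁ i (F.d 1 z) - f i • z = 0 := hinj _ (by
      rw [map_sub, hd₁, F.d_d, map_zero, map_smul, sub_zero, sub_self])
    rw [hα, sub_eq_zero.1 this, Pi.smul_apply, smul_eq_mul]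
  have hαh (i j x) : α i (h₀ j x) = 0 := by
    have : (α i).comp (h₀ j) = 0 := by
      refine LinearMap.pi_ext' fun n => LinearMap.ext_ring ?_
      refine eq_zero_of_mem_freePiece_of_lt
        (hh₁ i _ _ (hh₀ j _ _ (single_one_mem_freePiece (F.deg 0) n))) ?_
      have h := hd i
      have h' := hd j
      have h'' := hd n
      omega
    exact LinearMap.congr_fun this x
  have hαα (i j x) : f j * α i x = f i * α j x := by
    have h := congrArg (α i) (hd₁ j x)
    rw [hαd, map_sub, hαh, sub_zero, map_smul, smul_eq_mul] at h
    exact h.symm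
  obtain ⟨i, hi⟩ := F.exists_aug_single_ne_zero hJ
  have hdvd (x) : f i ∣ α i x :=
    dvd_of_forall_dvd_mul hgcd hi fun j => ⟨α j x, hαα i j x⟩
  -- Evaluate at the basis vector itself and divide by `f i`.
  have h := hαd i (Pi.single l 1)
  rw [Pi.single_eq_same, mul_one] at h
  choose β hβ using fun n => hdvd (Pi.single n 1)
  have hsum : α i (F.d 1 (Pi.single l 1)) =
      f i * ∑ n, F.d 1 (Pi.single l 1) n * β n := by
    conv_lhs => rw [pi_eq_sum_univ' (F.d 1 (Pi.single l 1))]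
    rw [map_sum, Finset.mul_sum]
    refine Finset.sum_congr rfl fun n _ => ?_
    rw [map_smul, smul_eq_mul, hβ]
    ring
  rw [h] at hsum
  have h1 := congrArg constantCoeff (mul_left_cancel₀ hi ((mul_one _).trans hsum))
  rw [map_one, map_sum] at h1
  refine one_ne_zero (h1.trans (Finset.sum_eq_zero fun n _ => ?_))
  rw [map_mul, hF.constantCoeff_d, zero_mul]

/-- The coordinate function `e` of a basis vector of `F 1` of large degree vanishes on the image of
`F 2` by minimality, and on the images of the homotopies `h i` for degree reasons, so that
`f i * e = 0`. -/
theorem IsMinimal.deg_one_le (hF : F.IsMinimal) (hJ : J ≠ ⊥) {d b : ℤ}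
    (hd : ∀ i, F.deg 0 i ≤ d) (hb : ∀ j, F.deg 2 j ≤ b + 1) (hdb : 2 * d ≤ b)
    (l : Fin (F.rank 1)) : F.deg 1 l ≤ b := by
  by_contra! hl
  obtain ⟨i, hi⟩ := F.exists_aug_single_ne_zero hJ
  obtain ⟨h₀, h₁, hd₀, hd₁, hh₀, hh₁⟩ := F.exists_homotopy i
  have hed (y) : F.d 1 y l = 0 := by
    have : (LinearMap.proj l).comp (F.d 1) = 0 := by
      refine LinearMap.pi_ext' fun n => LinearMap.ext_ring ?_
      change F.d 1 (Pi.single n 1) l = 0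
      have hn := F.d_graded 1 _ _ (single_one_mem_freePiece (F.deg 2) n)
      rcases (show F.deg 2 n ≤ F.deg 1 l by have := hb n; omega).lt_or_eq with h | h
      · exact eq_zero_of_mem_freePiece_of_lt hn h
      · have h0 := mem_freePiece.1 hn l
        rw [h, sub_self] at h0
        rw [eq_C_of_mem_polyPiece_zero h0, hF.constantCoeff_d, C_0]
    exact LinearMap.congr_fun this y
  have heh (x) : h₀ x l = 0 := by
    have : (LinearMap.proj l).comp h₀ = 0 := by
      refine LinearMap.pi_ext' fun n => LinearMap.ext_ring ?_
      refine eq_zero_of_mem_freePiece_of_lt (hh₀ _ _ (single_one_mem_freePiece (F.deg 0) n)) ?_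
      have h := hd i
      have h' := hd n
      omega
    exact LinearMap.congr_fun this x
  have h := congrFun (hd₁ (Pi.single l 1)) l
  rw [hed, Pi.sub_apply, heh, sub_zero, Pi.smul_apply, Pi.single_eq_same, smul_eq_mul,
    mul_one] at h
  exact hi h.symm

theorem IsMinimal.deg_zero_le (hF : F.IsMinimal)
    (hJ : J.IsHomogeneous (homogeneousSubmodule (Fin 3) k)) {m : ℕ} {f : Fin m → PolyRing k}
    {d : ℕ} (hspan : Ideal.span (Set.range f) = J) (hd : ∀ i, (f i).totalDegree ≤ d)
    (l : Fin (F.rank 0)) : F.deg 0 l ≤ d := by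
  by_contra! hl
  -- The image of the span of the other basis vectors contains all `f i`.
  have hle : J ≤ (LinearMap.ker (LinearMap.proj (R := PolyRing k)
      (φ := fun _ : Fin (F.rank 0) => PolyRing k) l)).map F.aug := by
    refine hspan.ge.trans (Ideal.span_le.2 ?_)
    rintro _ ⟨i, rfl⟩
    rw [← sum_homogeneousComponent (f i)]
    refine Submodule.sum_mem _ fun n hn => ?_
    have hn' : n ≤ d := (Nat.lt_succ_iff.1 (Finset.mem_range.1 hn)).trans (hd i)
    have hfi : f i ∈ J := hspan ▸ Ideal.subset_span ⟨i, rfl⟩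
    obtain ⟨v, hv⟩ := F.mem_range_aug_iff.2 (homogeneousComponent_mem_of_mem hJ hfi n)
    refine ⟨freeComp (F.deg 0) n v,
      eq_zero_of_mem_freePiece_of_lt (freeComp_mem _ _ _) (by omega), ?_⟩
    rw [← polyComp_map _ F.aug_graded, hv, polyComp_natCast,
      homogeneousComponent_eq_self (homogeneousComponent_isHomogeneous n _)]
  obtain ⟨w, hw, hwl⟩ := hle (F.mem_range_aug_iff.1 ⟨Pi.single l 1, rfl⟩)
  have hker : Pi.single l 1 - w ∈ LinearMap.range (F.d 0) := by
    rw [← F.exact_zero, LinearMap.mem_ker, map_sub, hwl, sub_self]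
  obtain ⟨y, hy⟩ := hker
  have h := hF.constantCoeff_d 0 y l
  have hw' : w l = 0 := hw
  rw [hy, Pi.sub_apply, hw', Pi.single_eq_same, sub_zero, map_one] at h
  exact one_ne_zero h

theorem IsMinimal.reg_le (hF : F.IsMinimal)
    (hJ : J.IsHomogeneous (homogeneousSubmodule (Fin 3) k)) (hJ₀ : J ≠ ⊥) {m : ℕ}
    {f : Fin m → PolyRing k} {d : ℕ} (hd₁ : 1 ≤ d) (hspan : Ideal.span (Set.range f) = J)
    (hgcd : ∀ g : PolyRing k, (∀ i, g ∣ f i) → IsUnit g)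
    (hd : ∀ i, (f i).totalDegree ≤ d) : F.reg ≤ 3 * (d : ℤ) - 2 := by
  have h₀ := hF.deg_zero_le hJ hspan hd
  have h₂ := hF.deg_two_le hJ₀ (fun g hg => hgcd g fun i => by
    have hle : J ≤ Ideal.span {g} := by
      rw [← F.range_aug]
      rintro _ ⟨v, rfl⟩
      rw [pi_eq_sum_univ' v, map_sum]
      refine Submodule.sum_mem _ fun j _ => ?_
      rw [map_smul]
      exact Submodule.smul_mem _ _ (Ideal.mem_span_singleton.2 (hg j))
    exact Ideal.mem_span_singleton.1 (hle (hspan ▸ Ideal.subset_span ⟨i, rfl⟩))) h₀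
  have h₁ := hF.deg_one_le hJ₀ (b := 3 * (d : ℤ) - 1) h₀ (by simpa using h₂) (by omega)
  obtain ⟨i, j, hij⟩ := mem_shifts_iff.1 (hF.isGreatest_reg hJ₀).1
  rw [hij]
  match i, j with
  | 0, j => have := h₀ j; push_cast; omega
  | 1, j => have := h₁ j; push_cast; omega
  | 2, j => have := h₂ j; push_cast; omega
  | i + 3, j => exact (Fin.cast (hF.rank_eq_zero (Nat.le_add_left 3 i)) j).elim0

end GradedFreeResolution

theorem mainTheorem8 {k : Type*} [Field k] (J : Ideal (PolyRing k))
    (hJ : J.IsHomogeneous (homogeneousSubmodule (Fin 3) k)) :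
    (∃ F : GradedFreeResolution J, F.IsMinimal) ∧
    ∀ F : GradedFreeResolution J, F.IsMinimal →
      (∀ (p : ℤ) (G : GradedFreeResolution J),
        F.gradedBetti 2 p = Module.finrank k (G.TorPiece 2 p)) ∧
      (∀ p : ℤ, (F.gradedBetti 2 p : ℤ) ≤ (hilbertFn J (p - 2) : ℤ) - (hilbertFn J (p - 3) : ℤ)) ∧
      (J ≠ ⊥ → IsGreatest F.shifts F.reg ∧ F.betti 2 ≤ hilbertFn J F.reg) ∧
      (∀ (m : ℕ) (f : Fin m → PolyRing k) (d : ℕ), 2 ≤ m → 1 ≤ d →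
        Ideal.span (Set.range f) = J →
        (∀ g : PolyRing k, (∀ i, g ∣ f i) → IsUnit g) →
        (∀ i, (f i).totalDegree ≤ d) →
        F.betti 2 ≤ hilbertFn J F.reg ∧ hilbertFn J F.reg ≤ hilbertFn J (3 * (d : ℤ) - 2)) := by
  refine ⟨exists_isMinimal hJ, fun F hF => ⟨fun p G => ?_, fun p => ?_, fun hJ₀ =>
    ⟨hF.isGreatest_reg hJ₀, hF.betti_two_le⟩, fun m f d _ hd₁ hspan hgcd hd =>
    ⟨hF.betti_two_le, hilbertFn_mono J (hF.reg_le hJ ?_ hd₁ hspan hgcd hd)⟩⟩⟩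
  · rw [← hF.finrank_torPiece_succ, ← sub_add_cancel p 3, F.finrank_torPiece_two,
      G.finrank_torPiece_two]
  · have h := hF.gradedBetti_two_add_hilbertFn_le (p - 3)
    rw [sub_add_cancel, show p - 3 + 1 = p - 2 by ring] at h
    omega
  · rintro rfl
    refine (X_prime (R := k) (i := (0 : Fin 3))).not_isUnit (hgcd _ fun i => ?_)
    have : f i ∈ (⊥ : Ideal (PolyRing k)) := hspan ▸ Ideal.subset_span ⟨i, rfl⟩
    rw [(Submodule.mem_bot _).1 this]
    exact dvd_zero _
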